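/- **Conventions.** A weight on $\mathbb Z$ is a function $\omega\colon\mathbb Z\to[1,\infty)$ with $\omega(0)=1$ and $\omega(m+n)\le\omega(m)\,\omega(n)$ for all $m,n\in\mathbb Z$. For a weight $\omega$, let $$\ell^1(\mathbb Z,\omega)=\Big\{f\colon\mathbb Z\to\mathbb C:\ \|f\|_\omega=\sum_{n\in\mathbb Z}|f(n)|\,\omega(n)<\infty\Big\},$$ a unital Banach algebra under convolution, and let $\delta_n\in\ell^1(\mathbb Z,\omega)$ be the point mass at $n$. For a Banach algebra $A$ the bidual $A''$ is regarded as a Banach algebra under the first Arens product $\Box$, given by $$\langle\Psi\,\Box\,\Phi,\lambda\rangle=\langle\Psi,\Phi\cdot\lambda\rangle,\qquad \langle\Phi\cdot\lambda,a\rangle=\langle\Phi,\lambda\cdot a\rangle,\qquad \langle\lambda\cdot a,b\rangle=\langle\lambda,ab\rangle$$ for $\Phi,\Psi\in A''$, $\lambda\in A'$, $a,b\in A$; $\operatorname{rad}(A'')$ denotes its Jacobson radical. For a set $S\subset\mathbb Z$ generating $\mathbb Z$ as a group, the word length $|n|_S$ is the least $r\ge 0$ such that $n=\sum_{i=1}^r\varepsilon_i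 s_i$ for some $s_1,\dots,s_r\in S$ and $\varepsilon_1,\dots,\varepsilon_r\in\{1,-1\}$. **Theorem 1.2.** There exists a weight $\omega$ on $\mathbb Z$ such that $\operatorname{rad}(\ell^1(\mathbb Z,\omega)'')$ contains an element that is not nilpotent. More precisely, let $S=\{2^{k^2}:k=0,1,2,\dots\}$, let $\omega(n)=e^{|n|_S}$ for $n\in\mathbb Z$, and let $n_k=2^{k^2}+2^{(k-1)^2}+\cdots+2^{1}+1=\sum_{i=0}^{k}2^{i^2}$ for $k=1,2,\dots$. Then $\omega$ is a weight on $\mathbb Z$; the set $\{\delta_{n_k}/\omega(n_k):k\ge 1\}$ has a weak-* accumulation point in $\ell^1(\mathbb Z,\omega)''$; and every weak-* accumulation point of this set in $\ell^1(\mathbb Z,\omega)''$ belongs to $\operatorname{rad}(\ell^1(\mathbb Z,\omega)'')$ and is not nilpotent. -/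

import Mathlib

/-! ## The bidual of a normed algebra with the first Arens product -/

section Arens

variable {A : Type*} [NormedRing A] [NormedAlgebra ℂ A]

/-- The bidual `A''` of a complex normed algebra `A`, which carries the first Arens product. -/
def Bidual (A : Type*) [NormedRing A] [NormedAlgebra ℂ A] : Type _ :=
  StrongDual ℂ (StrongDual ℂ A)

namespace Bidual

noncomputable instance : NormedAddCommGroup (Bidual A) :=
  inferInstanceAs (NormedAddCommGroup (StrongDual ℂ (StrongDual ℂ A)))

noncomputable instance : NormedSpace ℂ (Bidual A) :=
  inferInstanceAs (NormedSpace ℂ (StrongDual ℂ (StrongDual ℂ A)))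

instance : CompleteSpace (Bidual A) :=
  inferInstanceAs (CompleteSpace (StrongDual ℂ (StrongDual ℂ A)))

/-- An element of `A''` as a functional on `A'`. -/
def toFunctional (Φ : Bidual A) : StrongDual ℂ (StrongDual ℂ A) := Φ

/-- A functional on `A'` as an element of `A''`. -/
def ofFunctional (Φ : StrongDual ℂ (StrongDual ℂ A)) : Bidual A := Φ

@[ext] theorem ext {Φ Ψ : Bidual A} (h : ∀ l, Φ.toFunctional l = Ψ.toFunctional l) : Φ = Ψ :=
  ContinuousLinearMap.ext h

/-- `A''` as a set of points of the weak-* dual of `A'`. -/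
noncomputable def toWeakStar (Φ : Bidual A) : WeakDual ℂ (StrongDual ℂ A) :=
  StrongDual.toWeakDual Φ.toFunctional

/-- The canonical embedding of `A` in `A''`. -/
noncomputable def embed (a : A) : Bidual A :=
  ofFunctional (NormedSpace.inclusionInDoubleDual ℂ A a)

/-- The map `a ↦ l · a` from `A` to `A'`, where `⟨l · a, b⟩ = ⟨l, a b⟩`. -/
noncomputable def dualAct (l : StrongDual ℂ A) : A →L[ℂ] StrongDual ℂ A :=
  (ContinuousLinearMap.compL ℂ A A ℂ l).comp (ContinuousLinearMap.mul ℂ A)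

@[simp] theorem dualAct_apply (l : StrongDual ℂ A) (a b : A) : dualAct l a b = l (a * b) := rfl

theorem norm_dualAct_le (l : StrongDual ℂ A) : ‖dualAct l‖ ≤ ‖l‖ := by
  refine ContinuousLinearMap.opNorm_le_bound _ (norm_nonneg _) fun a => ?_
  refine ContinuousLinearMap.opNorm_le_bound _ (by positivity) fun b => ?_
  rw [dualAct_apply, mul_assoc]
  exact (l.le_opNorm _).trans (by gcongr; exact norm_mul_le a b)

/-- The map `l ↦ Φ · l` from `A'` to `A'`, where `⟨Φ · l, a⟩ = ⟨Φ, l · a⟩`. -/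
noncomputable def act (Φ : Bidual A) : StrongDual ℂ A →L[ℂ] StrongDual ℂ A :=
  LinearMap.mkContinuous
    { toFun := fun l => Φ.toFunctional.comp (dualAct l)
      map_add' := fun l m => by
        ext a
        have h : dualAct (l + m) a = dualAct l a + dualAct m a := by ext b; simp
        simp [h]
      map_smul' := fun c l => by
        ext a
        have h : dualAct (c • l) a = c • dualAct l a := by ext b; simp
        simp [h] }
    ‖Φ‖ fun l =>
      (ContinuousLinearMap.opNorm_comp_le _ _).trans
        (mul_le_mul_of_nonneg_left (norm_dualAct_le l) (norm_nonneg _))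

@[simp] theorem act_apply (Φ : Bidual A) (l : StrongDual ℂ A) (a : A) :
    act Φ l a = Φ.toFunctional (dualAct l a) := rfl

theorem norm_act_le (Φ : Bidual A) : ‖act Φ‖ ≤ ‖Φ‖ :=
  LinearMap.mkContinuous_norm_le _ (norm_nonneg _) _

/-- The first Arens product: `⟨Ψ □ Φ, l⟩ = ⟨Ψ, Φ · l⟩`. -/
noncomputable instance : Mul (Bidual A) :=
  ⟨fun Ψ Φ => ofFunctional (Ψ.toFunctional.comp (act Φ))⟩

noncomputable instance : One (Bidual A) := ⟨embed 1⟩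

@[simp] theorem mul_apply (Ψ Φ : Bidual A) (l : StrongDual ℂ A) :
    (Ψ * Φ).toFunctional l = Ψ.toFunctional (act Φ l) := rfl

@[simp] theorem embed_apply (a : A) (l : StrongDual ℂ A) : (embed a).toFunctional l = l a := rfl

@[simp] theorem one_apply (l : StrongDual ℂ A) : (1 : Bidual A).toFunctional l = l 1 := rfl

@[simp] theorem add_apply (Φ Ψ : Bidual A) (l : StrongDual ℂ A) :
    (Φ + Ψ).toFunctional l = Φ.toFunctional l + Ψ.toFunctional l := rfl

@[simp] theorem smul_apply (c : ℂ) (Φ : Bidual A) (l : StrongDual ℂ A) :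
    (c • Φ).toFunctional l = c * Φ.toFunctional l := rfl

@[simp] theorem zero_apply (l : StrongDual ℂ A) : (0 : Bidual A).toFunctional l = 0 := rfl

theorem act_one (l : StrongDual ℂ A) : act 1 l = l := by
  ext a; simp

theorem act_mul (Ψ Φ : Bidual A) (l : StrongDual ℂ A) : act (Ψ * Φ) l = act Ψ (act Φ l) := by
  ext a
  have h : act Φ (dualAct l a) = dualAct (act Φ l) a := by
    ext b
    have h' : dualAct (dualAct l a) b = dualAct l (a * b) := by ext c; simp [mul_assoc]
    simp [h']
  simp [h]

theorem norm_arens_le (Ψ Φ : Bidual A) : ‖Ψ * Φ‖ ≤ ‖Ψ‖ * ‖Φ‖ :=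
  (ContinuousLinearMap.opNorm_comp_le Ψ.toFunctional (act Φ)).trans
    (mul_le_mul_of_nonneg_left (norm_act_le Φ) (norm_nonneg _))

noncomputable instance : NormedRing (Bidual A) where
  __ := (inferInstance : NormedAddCommGroup (Bidual A))
  mul := (· * ·)
  one := 1
  left_distrib Φ Ψ Θ := by
    ext l
    have h : act (Ψ + Θ) l = act Ψ l + act Θ l := by ext a; simp
    change Φ.toFunctional (act (Ψ + Θ) l) = _
    rw [h, map_add]; rfl
  right_distrib Φ Ψ Θ := by ext l; rfl
  zero_mul Φ := by ext l; rfl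
  mul_zero Φ := by
    ext l
    have h : act 0 l = 0 := by ext a; simp
    change Φ.toFunctional (act 0 l) = _
    rw [h, map_zero]; rfl
  mul_assoc Φ Ψ Θ := by
    ext l
    change Φ.toFunctional (act Ψ (act Θ l)) = Φ.toFunctional (act (Ψ * Θ) l)
    rw [act_mul]
  one_mul Φ := by
    ext l
    change act Φ l 1 = _
    rw [act_apply]
    congr 1
    ext a; simp
  mul_one Φ := by
    ext l
    change Φ.toFunctional (act 1 l) = _
    rw [act_one]
  norm_mul_le := norm_arens_le

noncomputable instance : NormedAlgebra ℂ (Bidual A) where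
  __ := Algebra.ofModule (R := ℂ) (A := Bidual A) (fun c Φ Ψ => by ext l; rfl) (fun c Φ Ψ => by
    ext l
    have h : act (c • Ψ) l = c • act Ψ l := by ext a; simp
    change Φ.toFunctional (act (c • Ψ) l) = c • Φ.toFunctional (act Ψ l)
    rw [h, map_smul])
  norm_smul_le := norm_smul_le

end Bidual

end Arens

/-! ## Beurling algebras on the integers -/

/-- A weight on `ℤ`: a submultiplicative function `ℤ → [1, ∞)` with value `1` at `0`. -/
structure Weight where
  toFun : ℤ → ℝ
  one_le' : ∀ n, 1 ≤ toFun n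
  map_add_le' : ∀ m n, toFun (m + n) ≤ toFun m * toFun n
  map_zero' : toFun 0 = 1

namespace Weight

instance : CoeFun Weight fun _ => ℤ → ℝ := ⟨toFun⟩

theorem one_le (ω : Weight) (n : ℤ) : 1 ≤ ω n := ω.one_le' n

theorem nonneg (ω : Weight) (n : ℤ) : 0 ≤ ω n := zero_le_one.trans (ω.one_le n)

end Weight

/-- The functions `f : ℤ → ℂ` such that `∑ |f n| ω n < ∞`. -/
def beurlingSubmodule (ω : Weight) : Submodule ℂ (ℤ → ℂ) where
  carrier := {f | Summable fun n => ‖f n‖ * ω n}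
  zero_mem' := by simp
  add_mem' {f g} hf hg := by
    refine Summable.of_nonneg_of_le (fun n => mul_nonneg (norm_nonneg _) (ω.nonneg n))
      (fun n => ?_) (Summable.add hf hg)
    rw [← add_mul]
    exact mul_le_mul_of_nonneg_right (norm_add_le _ _) (ω.nonneg n)
  smul_mem' c f hf := by
    refine (Summable.mul_left ‖c‖ hf).congr fun n => ?_
    simp [mul_assoc]

/-- The Beurling algebra `ℓ¹(ℤ, ω)`. -/
def Beurling (ω : Weight) : Type := beurlingSubmodule ω

namespace Beurling

variable {ω : Weight}

noncomputable instance : AddCommGroup (Beurling ω) :=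
  inferInstanceAs (AddCommGroup (beurlingSubmodule ω))

noncomputable instance : Module ℂ (Beurling ω) :=
  inferInstanceAs (Module ℂ (beurlingSubmodule ω))

instance : CoeFun (Beurling ω) fun _ => ℤ → ℂ := ⟨fun f => f.1⟩

@[ext] theorem ext {f g : Beurling ω} (h : ∀ n, f n = g n) : f = g := Subtype.ext (funext h)

@[simp] theorem add_apply (f g : Beurling ω) (n : ℤ) : (f + g) n = f n + g n := rfl
@[simp] theorem neg_apply (f : Beurling ω) (n : ℤ) : (-f) n = -f n := rfl
@[simp] theorem zero_apply (n : ℤ) : (0 : Beurling ω) n = 0 := rfl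
@[simp] theorem smul_apply (c : ℂ) (f : Beurling ω) (n : ℤ) : (c • f) n = c * f n := rfl

theorem summable_weighted (f : Beurling ω) : Summable fun n => ‖f n‖ * ω n := f.2

theorem summable_norm (f : Beurling ω) : Summable fun n => ‖f n‖ :=
  Summable.of_nonneg_of_le (fun _ => norm_nonneg _)
    (fun n => le_mul_of_one_le_right (norm_nonneg _) (ω.one_le n)) f.summable_weighted

/-- The norm `‖f‖ = ∑ |f n| ω n`. -/
noncomputable instance : Norm (Beurling ω) := ⟨fun f => ∑' n, ‖f n‖ * ω n⟩

theorem norm_def (f : Beurling ω) : ‖f‖ = ∑' n, ‖f n‖ * ω n := rfl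

theorem weighted_nonneg (f : Beurling ω) (n : ℤ) : 0 ≤ ‖f n‖ * ω n :=
  mul_nonneg (norm_nonneg _) (ω.nonneg n)

theorem normCore : NormedSpace.Core ℂ (Beurling ω) where
  norm_nonneg f := tsum_nonneg f.weighted_nonneg
  norm_smul c f := by
    simp only [norm_def, smul_apply, norm_mul, mul_assoc]
    exact tsum_mul_left
  norm_triangle f g := by
    rw [norm_def, norm_def, norm_def, ← f.summable_weighted.tsum_add g.summable_weighted]
    refine (f + g).summable_weighted.tsum_le_tsum (fun n => ?_)
      (f.summable_weighted.add g.summable_weighted)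
    rw [← add_mul]
    exact mul_le_mul_of_nonneg_right (norm_add_le _ _) (ω.nonneg n)
  norm_eq_zero_iff f := by
    constructor
    · intro h
      have h0 := (hasSum_zero_iff_of_nonneg f.weighted_nonneg).1
        (by rw [← h]; exact f.summable_weighted.hasSum)
      ext n
      have hn := congrFun h0 n
      have hω : ω n ≠ 0 := (zero_lt_one.trans_le (ω.one_le n)).ne'
      simpa [hω] using hn
    · rintro rfl
      simp [norm_def]

noncomputable instance : NormedAddCommGroup (Beurling ω) := NormedAddCommGroup.ofCore normCore

noncomputable instance : NormedSpace ℂ (Beurling ω) := NormedSpace.ofCore normCore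

/-- The bijection `(n, m) ↦ (m, n - m)` of `ℤ × ℤ`. -/
def shear : ℤ × ℤ ≃ ℤ × ℤ where
  toFun p := (p.2, p.1 - p.2)
  invFun p := (p.1 + p.2, p.1)
  left_inv p := by ext <;> simp
  right_inv p := by ext <;> simp

theorem summable_pair (f g : Beurling ω) :
    Summable fun p : ℤ × ℤ => (‖f p.2‖ * ω p.2) * (‖g (p.1 - p.2)‖ * ω (p.1 - p.2)) :=
  shear.summable_iff.2 (f.summable_weighted.mul_of_nonneg g.summable_weighted
    f.weighted_nonneg g.weighted_nonneg)

theorem tsum_pair (f g : Beurling ω) :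
    ∑' p : ℤ × ℤ, (‖f p.2‖ * ω p.2) * (‖g (p.1 - p.2)‖ * ω (p.1 - p.2)) = ‖f‖ * ‖g‖ := by
  rw [norm_def, norm_def, f.summable_weighted.tsum_mul_tsum g.summable_weighted
    (f.summable_weighted.mul_of_nonneg g.summable_weighted f.weighted_nonneg g.weighted_nonneg)]
  exact shear.tsum_eq fun p : ℤ × ℤ => (‖f p.1‖ * ω p.1) * (‖g p.2‖ * ω p.2)

theorem summable_pair_norm (f g : Beurling ω) :
    Summable fun p : ℤ × ℤ => ‖f p.2‖ * ‖g (p.1 - p.2)‖ :=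
  shear.summable_iff.2 (f.summable_norm.mul_of_nonneg g.summable_norm
    (fun _ => norm_nonneg _) (fun _ => norm_nonneg _))

theorem summable_conv (f g : Beurling ω) (n : ℤ) : Summable fun m => f m * g (n - m) := by
  refine Summable.of_norm ?_
  simpa using (f.summable_pair_norm g).prod_factor n

theorem norm_conv_le (f g : Beurling ω) (n : ℤ) :
    ‖∑' m, f m * g (n - m)‖ * ω n ≤
      ∑' m, (‖f m‖ * ω m) * (‖g (n - m)‖ * ω (n - m)) := by
  have hs : Summable fun m => ‖f m * g (n - m)‖ := by
    simpa using (f.summable_pair_norm g).prod_factor n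
  calc ‖∑' m, f m * g (n - m)‖ * ω n
      ≤ (∑' m, ‖f m * g (n - m)‖) * ω n :=
        mul_le_mul_of_nonneg_right (norm_tsum_le_tsum_norm hs) (ω.nonneg n)
    _ = ∑' m, ‖f m * g (n - m)‖ * ω n := tsum_mul_right.symm
    _ ≤ _ := by
      refine (hs.mul_right _).tsum_le_tsum (fun m => ?_) ((f.summable_pair g).prod_factor n)
      have h := ω.map_add_le' m (n - m)
      rw [add_sub_cancel] at h
      rw [norm_mul]
      calc ‖f m‖ * ‖g (n - m)‖ * ω n ≤ ‖f m‖ * ‖g (n - m)‖ * (ω m * ω (n - m)) :=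
            mul_le_mul_of_nonneg_left h (by positivity)
        _ = _ := by ring

/-- Convolution: `(f * g) n = ∑ₘ f m g (n - m)`. -/
noncomputable instance : Mul (Beurling ω) :=
  ⟨fun f g => ⟨fun n => ∑' m, f m * g (n - m),
    Summable.of_nonneg_of_le (fun n => mul_nonneg (norm_nonneg _) (ω.nonneg n))
      (f.norm_conv_le g) (f.summable_pair g).prod⟩⟩

theorem mul_apply (f g : Beurling ω) (n : ℤ) : (f * g) n = ∑' m, f m * g (n - m) := rfl

theorem norm_mul_le' (f g : Beurling ω) : ‖f * g‖ ≤ ‖f‖ * ‖g‖ := by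
  rw [← tsum_pair, (f.summable_pair g).tsum_prod]
  exact (f * g).summable_weighted.tsum_le_tsum (f.norm_conv_le g) (f.summable_pair g).prod

/-- The point mass at `k`. -/
noncomputable def delta (ω : Weight) (k : ℤ) : Beurling ω :=
  ⟨Pi.single k 1, summable_of_ne_finset_zero (s := {k}) fun n hn => by
    rw [Pi.single_eq_of_ne (by simpa using hn)]; simp⟩

theorem delta_apply (k n : ℤ) : delta ω k n = if n = k then 1 else 0 :=
  Pi.single_apply k 1 n

noncomputable instance : One (Beurling ω) := ⟨delta ω 0⟩

theorem mul_comm' (f g : Beurling ω) : f * g = g * f := by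
  ext n
  rw [mul_apply, mul_apply, ← (Equiv.subLeft n).tsum_eq]
  exact tsum_congr fun m => by simp [mul_comm]

theorem one_mul' (f : Beurling ω) : 1 * f = f := by
  ext n
  change ∑' m, delta ω 0 m * f (n - m) = f n
  rw [tsum_eq_single 0 fun m hm => by simp [delta_apply, hm]]
  simp [delta_apply]

theorem add_mul' (f g h : Beurling ω) : (f + g) * h = f * h + g * h := by
  ext n
  rw [add_apply, mul_apply, mul_apply, mul_apply,
    ← (f.summable_conv h n).tsum_add (g.summable_conv h n)]
  exact tsum_congr fun m => by rw [add_apply, add_mul]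

theorem mul_assoc' (f g h : Beurling ω) : f * g * h = f * (g * h) := by
  ext n
  have hb : ∀ m, ‖h m‖ ≤ ∑' k, ‖h k‖ := fun m =>
    h.summable_norm.le_tsum m fun _ _ => norm_nonneg _
  have hF : Summable fun p : ℤ × ℤ => f p.2 * g (p.1 - p.2) * h (n - p.1) := by
    refine Summable.of_norm_bounded ((f.summable_pair_norm g).mul_right (∑' k, ‖h k‖))
      fun p => ?_
    rw [norm_mul, norm_mul]
    exact mul_le_mul_of_nonneg_left (hb _) (by positivity)
  have h1 : ∀ m, (f * g) m * h (n - m) = ∑' k, f k * g (m - k) * h (n - m) := fun m => by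
    rw [mul_apply, tsum_mul_right]
  have h2 : ∀ k, f k * (g * h) (n - k) = ∑' m, f k * g (m - k) * h (n - m) := fun k => by
    rw [mul_apply, ← tsum_mul_left, ← (Equiv.subRight k).tsum_eq]
    refine tsum_congr fun m => ?_
    rw [Equiv.subRight_apply, sub_sub_sub_cancel_right, mul_assoc]
  rw [mul_apply (f * g) h, mul_apply f (g * h), tsum_congr h1, tsum_congr h2]
  exact (Summable.tsum_comm (f := fun m k => f k * g (m - k) * h (n - m)) hF).symm

noncomputable instance : NormedCommRing (Beurling ω) where
  __ := (inferInstance : NormedAddCommGroup (Beurling ω))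
  mul := (· * ·)
  one := 1
  left_distrib f g h := by
    rw [mul_comm' f, add_mul', mul_comm' g, mul_comm' h]
  right_distrib := add_mul'
  zero_mul f := by ext n; simp [mul_apply]
  mul_zero f := by ext n; simp [mul_apply]
  mul_assoc := mul_assoc'
  one_mul := one_mul'
  mul_one f := by rw [mul_comm', one_mul']
  mul_comm := mul_comm'
  norm_mul_le := norm_mul_le'

noncomputable instance : NormedAlgebra ℂ (Beurling ω) where
  __ := Algebra.ofModule (R := ℂ) (A := Beurling ω)
    (fun c f g => by
      ext n
      rw [smul_apply, mul_apply, mul_apply, ← tsum_mul_left]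
      exact tsum_congr fun m => by rw [smul_apply, mul_assoc])
    (fun c f g => by
      ext n
      rw [smul_apply, mul_apply, mul_apply, ← tsum_mul_left]
      exact tsum_congr fun m => by rw [smul_apply, mul_left_comm])
  norm_smul_le := norm_smul_le

end Beurling

/-! ## Word length -/

/-- The word length of `n` with respect to a generating set `S` of `ℤ`: the least `r` such that `n`
is a sum of `r` terms `± s` with `s ∈ S`. -/
noncomputable def wordLength (S : Set ℤ) (n : ℤ) : ℕ :=
  sInf {r : ℕ | ∃ s ε : Fin r → ℤ,
    (∀ i, s i ∈ S) ∧ (∀ i, ε i = 1 ∨ ε i = -1) ∧ n = ∑ i, ε i * s i}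

/-- The set `{2 ^ (k ^ 2) : k = 0, 1, 2, …}`. -/
def squarePowers : Set ℤ := Set.range fun k : ℕ => 2 ^ (k ^ 2)

/-- `n_k = 2 ^ (k ^ 2) + 2 ^ ((k - 1) ^ 2) + ⋯ + 1`. -/
def squarePowerSum (k : ℕ) : ℤ := ∑ i ∈ Finset.range (k + 1), 2 ^ (i ^ 2)

/-- The set `{δ_{n_k} / ω(n_k) : k = 1, 2, …}` in the bidual of `ℓ¹(ℤ, ω)`, with the weak-*
topology. -/
noncomputable def normalizedPointMasses (ω : Weight) :
    Set (WeakDual ℂ (StrongDual ℂ (Beurling ω))) :=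
  {x | ∃ k : ℕ, 1 ≤ k ∧ x = (Bidual.embed
    ((ω (squarePowerSum k) : ℂ)⁻¹ • Beurling.delta ω (squarePowerSum k))).toWeakStar}

/-!
Elements of a commutative algebra `A` are central in `A''`, so norms of products of `r` elements of
a set `T ⊆ A` control `‖(Ψ □ Φ) ^ r‖` for every weak-* limit `Φ` of `T` and every `Ψ`, and values of
a functional on such products control the values of `Φ ^ r`. For `T = {δ_{n_k} / ω(n_k) : k ≥ J}`
both come down to comparing `|n_{k_1} + ⋯ + n_{k_r}|` with `|n_{k_1}| + ⋯ + |n_{k_r}|`.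

Adding up `r = 2 ^ J ^ 2` of the `n_k` carries all the digits below `2 ^ J ^ 2` into that position,
at a saving of about `r * J` letters. Hence `‖(Ψ □ Φ) ^ r‖ ≤ (‖Ψ‖ exp (3 - J)) ^ r`, which is less
than `1` for large `J`, and `Φ` is in the radical. For fixed `r`, on the other hand, the ratio
`2 ^ (2 * l + 1)` of consecutive generators exceeds `2 * r` from `l = r` on, so that carries save at
most `2 * r ^ 2` letters, whatever the `k_i` are, and `Φ ^ r ≠ 0`.
-/

/-! ## Weak-* closures in the bidual -/

section Bidual

open scoped Pointwise

namespace Bidual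

section NormedRing

variable {A : Type*} [NormedRing A] [NormedAlgebra ℂ A]

theorem norm_embed_le (a : A) : ‖embed a‖ ≤ ‖a‖ :=
  NormedSpace.double_dual_bound ℂ A a

theorem embed_toWeakStar_injective : Function.Injective fun a : A => (embed a).toWeakStar :=
  fun _ _ h =>
    (NormedSpace.inclusionInDoubleDualLi ℂ (E := A)).injective (StrongDual.toWeakDual.injective h)

theorem exists_accPt_of_isBounded_of_infinite {T : Set A} (hT : Bornology.IsBounded T)
    (hinf : T.Infinite) :
    ∃ Φ : Bidual A,
      AccPt Φ.toWeakStar (Filter.principal ((fun a => (embed a).toWeakStar) '' T)) := by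
  obtain ⟨C, hC⟩ := hT.exists_norm_le
  have hsub : (fun a => (embed a).toWeakStar) '' T ⊆
      WeakDual.toStrongDual ⁻¹' Metric.closedBall (0 : StrongDual ℂ (StrongDual ℂ A)) C := by
    rintro _ ⟨a, ha, rfl⟩
    exact mem_closedBall_zero_iff.2 ((norm_embed_le a).trans (hC a ha))
  have himage := hinf.image embed_toWeakStar_injective.injOn
  obtain ⟨x, -, hx⟩ :=
    himage.exists_accPt_of_subset_isCompact (WeakDual.isCompact_closedBall 0 C) hsub
  exact ⟨ofFunctional (WeakDual.toStrongDual x), hx⟩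

/-- The weak-* closure in `A''` of a subset of `A`. -/
def weakStarClosure (T : Set A) : Set (Bidual A) :=
  toWeakStar ⁻¹' closure ((fun a => (embed a).toWeakStar) '' T)

variable {T : Set A} {Φ : Bidual A}

theorem apply_mem_of_mem_weakStarClosure (hΦ : Φ ∈ weakStarClosure T) {D : Set ℂ}
    (hD : IsClosed D) {l : StrongDual ℂ A} (hl : ∀ a ∈ T, l a ∈ D) : Φ.toFunctional l ∈ D := by
  have hclosed : IsClosed {x : WeakDual ℂ (StrongDual ℂ A) | x l ∈ D} :=
    hD.preimage (WeakDual.eval_continuous l)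
  have hsub : (fun a => (embed a).toWeakStar) '' T ⊆
      {x : WeakDual ℂ (StrongDual ℂ A) | x l ∈ D} := by
    rintro _ ⟨a, ha, rfl⟩
    exact hl a ha
  exact closure_minimal hsub hclosed hΦ

theorem pow_apply_mem_of_mem_weakStarClosure (hΦ : Φ ∈ weakStarClosure T) {D : Set ℂ}
    (hD : IsClosed D) {r : ℕ} {l : StrongDual ℂ A} (hl : ∀ a ∈ T ^ r, l a ∈ D) :
    (Φ ^ r).toFunctional l ∈ D := by
  induction r generalizing l with
  | zero => simpa using hl
  | succ r ih =>
    rw [pow_succ, mul_apply]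
    refine ih fun a ha => apply_mem_of_mem_weakStarClosure hΦ hD fun b hb => ?_
    exact hl (a * b) (pow_succ T r ▸ Set.mul_mem_mul ha hb)

theorem not_isNilpotent_of_mem_weakStarClosure (hΦ : Φ ∈ weakStarClosure T) (l : StrongDual ℂ A)
    (hl : ∀ r : ℕ, ∃ c > 0, ∀ a ∈ T ^ r, c ≤ (l a).re) : ¬ IsNilpotent Φ := by
  rintro ⟨r, hr⟩
  obtain ⟨c, hc, hcl⟩ := hl r
  have hmem : (Φ ^ r).toFunctional l ∈ {z : ℂ | c ≤ z.re} :=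
    pow_apply_mem_of_mem_weakStarClosure hΦ
      (isClosed_le continuous_const Complex.continuous_re) hcl
  rw [hr] at hmem
  exact hc.not_ge hmem

theorem norm_mul_le_of_mem_weakStarClosure (hΦ : Φ ∈ weakStarClosure T) {Θ : Bidual A} {C : ℝ}
    (hC : 0 ≤ C) (hT : ∀ a ∈ T, ‖embed a * Θ‖ ≤ C) : ‖Φ * Θ‖ ≤ C := by
  refine ContinuousLinearMap.opNorm_le_bound _ hC fun l => ?_
  have hball : (Φ * Θ).toFunctional l ∈ Metric.closedBall (0 : ℂ) (C * ‖l‖) :=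
    apply_mem_of_mem_weakStarClosure hΦ Metric.isClosed_closedBall fun a ha =>
      mem_closedBall_zero_iff.2 ((embed a * Θ).toFunctional.le_of_opNorm_le (hT a ha) l)
  exact mem_closedBall_zero_iff.1 hball

theorem embed_mul (a b : A) : embed (a * b) = embed a * embed b := rfl

end NormedRing

section NormedCommRing

variable {A : Type*} [NormedCommRing A] [NormedAlgebra ℂ A] {T : Set A} {Φ : Bidual A}

theorem embed_commute (a : A) (Ψ : Bidual A) : Commute (embed a) Ψ := by
  ext l
  have h : act (embed a) l = dualAct l a := by
    ext b
    simp [mul_comm]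
  simp [h]

/-- The Arens product is weak-* continuous only in its left factor. As elements of `A` are central
in `A''`, each factor `Φ` can be moved to the left of the elements of `A` replacing the others. -/
theorem norm_mul_pow_mul_le_of_mem_weakStarClosure (hΦ : Φ ∈ weakStarClosure T)
    (Ψ : Bidual A) {Θ : Bidual A} {r : ℕ} {C : ℝ} (hC : 0 ≤ C)
    (hT : ∀ a ∈ T ^ r, ‖embed a * Θ‖ ≤ C) : ‖(Ψ * Φ) ^ r * Θ‖ ≤ ‖Ψ‖ ^ r * C := by
  induction r generalizing Θ C with
  | zero =>
    have h1 := hT 1 (by simp)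
    change ‖(1 : Bidual A) * Θ‖ ≤ C at h1
    simpa using h1
  | succ r ih =>
    rw [pow_succ, mul_assoc _ (Ψ * Φ), pow_succ ‖Ψ‖, mul_assoc (‖Ψ‖ ^ r)]
    refine ih (by positivity) fun a ha => ?_
    have hmove : embed a * (Ψ * Φ * Θ) = Ψ * (Φ * (embed a * Θ)) := by
      rw [← mul_assoc, (embed_commute a (Ψ * Φ)).eq, mul_assoc, mul_assoc]
    have hbound : ‖Φ * (embed a * Θ)‖ ≤ C :=
      norm_mul_le_of_mem_weakStarClosure hΦ hC fun b hb => by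
        rw [← mul_assoc, ← embed_mul, mul_comm b]
        exact hT _ (pow_succ T r ▸ Set.mul_mem_mul ha hb)
    rw [hmove]
    exact (norm_mul_le _ _).trans (by gcongr)

theorem norm_mul_pow_le_of_mem_weakStarClosure (hΦ : Φ ∈ weakStarClosure T) (Ψ : Bidual A)
    {r : ℕ} {C : ℝ} (hC : 0 ≤ C) (hT : ∀ a ∈ T ^ r, ‖a‖ ≤ C) :
    ‖(Ψ * Φ) ^ r‖ ≤ ‖Ψ‖ ^ r * C := by
  rw [← mul_one ((Ψ * Φ) ^ r)]
  refine norm_mul_pow_mul_le_of_mem_weakStarClosure hΦ Ψ hC fun a ha => ?_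
  rw [mul_one]
  exact (norm_embed_le a).trans (hT a ha)

end NormedCommRing

end Bidual

theorem isUnit_one_sub_of_norm_pow_lt_one {R : Type*} [NormedRing R] [HasSummableGeomSeries R]
    {x : R} {r : ℕ} (h : ‖x ^ r‖ < 1) : IsUnit (1 - x) := by
  have hu : IsUnit (1 - x ^ r) := isUnit_one_sub_of_norm_lt_one h
  rw [← mul_neg_geom_sum] at hu
  have hc : Commute (1 - x) (∑ i ∈ Finset.range r, x ^ i) :=
    Commute.sum_right _ _ _ fun i _ =>
      (Commute.one_left _).sub_left ((Commute.refl x).pow_right i)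
  exact (hc.isUnit_mul_iff.1 hu).1

theorem mem_jacobson_of_forall_norm_mul_pow_lt_one {R : Type*} [NormedRing R]
    [HasSummableGeomSeries R] {x : R} (h : ∀ y : R, ∃ r : ℕ, ‖(y * x) ^ r‖ < 1) :
    x ∈ Ring.jacobson R := by
  rw [← Ideal.jacobson_bot, Ideal.mem_jacobson_iff]
  intro y
  obtain ⟨r, hr⟩ := h (-y)
  obtain ⟨z, hz⟩ := (isUnit_one_sub_of_norm_pow_lt_one hr).exists_left_inv
  refine ⟨z, ?_⟩
  rw [Ideal.mem_bot, sub_eq_zero, ← hz]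
  noncomm_ring

theorem Bidual.mem_jacobson_of_mem_weakStarClosure {A : Type*} [NormedCommRing A]
    [NormedAlgebra ℂ A] {Φ : Bidual A}
    (h : ∀ ε > 0, ∃ T : Set A, Φ ∈ weakStarClosure T ∧
      ∃ r : ℕ, r ≠ 0 ∧ ∀ a ∈ T ^ r, ‖a‖ ≤ ε ^ r) :
    Φ ∈ Ring.jacobson (Bidual A) := by
  refine mem_jacobson_of_forall_norm_mul_pow_lt_one fun Ψ => ?_
  have hpos : 0 < ‖Ψ‖ + 1 := by positivity
  obtain ⟨T, hΦ, r, hr, hT⟩ := h (‖Ψ‖ + 1)⁻¹ (by positivity)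
  refine ⟨r, ?_⟩
  calc ‖(Ψ * Φ) ^ r‖ ≤ ‖Ψ‖ ^ r * (‖Ψ‖ + 1)⁻¹ ^ r :=
        norm_mul_pow_le_of_mem_weakStarClosure hΦ Ψ (by positivity) hT
    _ = (‖Ψ‖ / (‖Ψ‖ + 1)) ^ r := by rw [← mul_pow, div_eq_mul_inv]
    _ < 1 := pow_lt_one₀ (by positivity) ((div_lt_one hpos).2 (lt_add_one _)) hr

end Bidual

theorem mem_closure_of_accPt_of_subset_union {X : Type*} [TopologicalSpace X] [T1Space X] {x : X}
    {s F t : Set X} (h : AccPt x (Filter.principal s)) (hF : F.Finite) (hs : s ⊆ F ∪ t) :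
    x ∈ closure t := by
  have hFt : AccPt x (Filter.principal F ⊔ Filter.principal t) := by
    rw [Filter.sup_principal]
    exact h.mono (Filter.principal_mono.2 hs)
  rcases accPt_sup.1 hFt with hx | hx
  · exact absurd hF (Set.Infinite.of_accPt hx)
  · exact mem_closure_iff_clusterPt.2 hx.clusterPt

/-! ## Carries and word length -/

section MixedRadix

theorem add_abs_le_of_carry {a r c e e' Q : ℤ} (ha : 0 ≤ a) (har : a ≤ r) (hQ : 0 < Q)
    (he : e + (a - c) = e' * Q) :
    a + |e'| ≤ |c| + |e| + if 2 * r < Q then 0 else 2 * r := by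
  have habs : |e'| * Q ≤ |c| + |e| + a := by
    calc |e'| * Q = |e + (a - c)| := by rw [he, abs_mul, abs_of_pos hQ]
      _ ≤ |e| + (|a| + |c|) := (abs_add_le _ _).trans (by gcongr; exact abs_sub a c)
      _ = |c| + |e| + a := by rw [abs_of_nonneg ha]; ring
  split_ifs with hr
  · rcases eq_or_ne e' 0 with rfl | he'
    · have := le_abs_self c
      have := neg_abs_le e
      rw [abs_zero]
      linarith
    · have := Int.one_le_abs he'
      nlinarith
  · have := le_mul_of_one_le_right (abs_nonneg e') hQ
    linarith

variable {b Q : ℕ → ℤ} {r : ℤ}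

/-- Here `e` is the carry into position `L`. A carry costs the digit string `c` at least as much as
it saves, except at positions where the radix is at most twice the largest digit. -/
theorem sum_add_abs_le_of_carry (hb0 : b 0 ≠ 0) (hb : ∀ l, b (l + 1) = Q l * b l)
    (hQ : ∀ l, 0 < Q l) {a c : ℕ → ℤ} (ha : ∀ l, 0 ≤ a l) (har : ∀ l, a l ≤ r) {L : ℕ} {e : ℤ}
    (he : ∑ l ∈ Finset.range L, (a l - c l) * b l = e * b L) :
    ∑ l ∈ Finset.range L, a l + |e| ≤
      ∑ l ∈ Finset.range L, |c l| + ∑ l ∈ Finset.range L, if 2 * r < Q l then 0 else 2 * r := by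
  induction L generalizing e with
  | zero =>
    have he0 : e = 0 := by simpa [hb0] using he.symm
    simp [he0]
  | succ L ih =>
    rw [Finset.sum_range_succ, hb] at he
    have hprev := ih (e := e * Q L - (a L - c L)) (by linear_combination he)
    have hstep := add_abs_le_of_carry (ha L) (har L) (hQ L)
      (sub_add_cancel (e * Q L) (a L - c L))
    simp only [Finset.sum_range_succ]
    linarith

theorem sum_le_sum_abs_add_of_mixedRadix (hb0 : b 0 ≠ 0) (hb : ∀ l, b (l + 1) = Q l * b l)
    (hQ : ∀ l, 0 < Q l) {N : ℕ} (hr : 0 ≤ r) (hN : ∀ l, N ≤ l → 2 * r < Q l) {a c : ℕ → ℤ}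
    (ha : ∀ l, 0 ≤ a l) (har : ∀ l, a l ≤ r) {L : ℕ}
    (hac : ∑ l ∈ Finset.range L, a l * b l = ∑ l ∈ Finset.range L, c l * b l) :
    ∑ l ∈ Finset.range L, a l ≤ ∑ l ∈ Finset.range L, |c l| + N * (2 * r) := by
  have hcarry := sum_add_abs_le_of_carry hb0 hb hQ ha har (c := c) (L := L) (e := 0)
    (by simp only [sub_mul, Finset.sum_sub_distrib, hac, sub_self, zero_mul])
  have hloss : (∑ l ∈ Finset.range L, if 2 * r < Q l then 0 else 2 * r) ≤ N * (2 * r) := by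
    calc (∑ l ∈ Finset.range L, if 2 * r < Q l then 0 else 2 * r)
        ≤ ∑ l ∈ Finset.range L, if l < N then 2 * r else 0 :=
          Finset.sum_le_sum fun l _ => by
            rcases lt_or_ge l N with hl | hl
            · split_ifs <;> linarith
            · simp [hN l hl, hl.not_gt]
      _ = ((Finset.range L).filter (· < N)).card * (2 * r) := by
          rw [← Finset.sum_filter, Finset.sum_const, nsmul_eq_mul]
      _ ≤ N * (2 * r) := by
          gcongr
          refine (Finset.card_le_card fun l hl => ?_).trans_eq (Finset.card_range N)
          exact Finset.mem_range.2 (Finset.mem_filter.1 hl).2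
  rw [abs_zero, add_zero] at hcarry
  linarith

end MixedRadix

/-- `n` is a sum of `r` terms `± s` with `s ∈ S`; `wordLength S n` is the least such `r`. -/
def IsWordOfLength (S : Set ℤ) (r : ℕ) (n : ℤ) : Prop :=
  ∃ s ε : Fin r → ℤ, (∀ i, s i ∈ S) ∧ (∀ i, ε i = 1 ∨ ε i = -1) ∧ n = ∑ i, ε i * s i

namespace IsWordOfLength

variable {S : Set ℤ} {r t : ℕ} {m n : ℤ}

theorem wordLength_le (h : IsWordOfLength S r n) : wordLength S n ≤ r := Nat.sInf_le h

theorem zero (S : Set ℤ) : IsWordOfLength S 0 0 :=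
  ⟨Fin.elim0, Fin.elim0, fun i => i.elim0, fun i => i.elim0, by simp⟩

theorem of_mem (hn : n ∈ S) : IsWordOfLength S 1 n :=
  ⟨fun _ => n, fun _ => 1, fun _ => hn, fun _ => Or.inl rfl, by simp⟩

theorem neg (h : IsWordOfLength S r n) : IsWordOfLength S r (-n) := by
  obtain ⟨s, ε, hs, hε, rfl⟩ := h
  exact ⟨s, -ε, hs, fun i => by simpa [neg_eq_iff_eq_neg, or_comm] using hε i, by simp⟩

theorem add (hm : IsWordOfLength S r m) (hn : IsWordOfLength S t n) :
    IsWordOfLength S (r + t) (m + n) := by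
  obtain ⟨s, ε, hs, hε, rfl⟩ := hm
  obtain ⟨s', ε', hs', hε', rfl⟩ := hn
  refine ⟨Fin.append s s', Fin.append ε ε', Fin.addCases ?_ ?_, Fin.addCases ?_ ?_, ?_⟩
  · simp [Fin.sum_univ_add]
  · simpa using hs
  · simpa using hs'
  · simpa using hε
  · simpa using hε'

theorem exists_linearCombination {κ : Type*} {b : κ → ℤ} (h : IsWordOfLength (Set.range b) r n) :
    ∃ c : κ →₀ ℤ, Finsupp.linearCombination ℤ b c = n ∧ ∀ t : Finset κ, ∑ l ∈ t, |c l| ≤ r := by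
  classical
  obtain ⟨s, ε, hs, hε, rfl⟩ := h
  choose k hk using hs
  refine ⟨∑ i, Finsupp.single (k i) (ε i), by simp [hk], fun t => ?_⟩
  have hsingle : ∀ i, ∑ l ∈ t, |Finsupp.single (k i) (ε i) l| ≤ 1 := fun i => by
    have hεi : |ε i| = 1 := by rcases hε i with h | h <;> simp [h]
    simp only [Finsupp.single_apply, apply_ite abs, hεi, abs_zero, Finset.sum_ite_eq]
    split_ifs <;> simp
  calc ∑ l ∈ t, |(∑ i, Finsupp.single (k i) (ε i)) l|
      ≤ ∑ l ∈ t, ∑ i, |Finsupp.single (k i) (ε i) l| :=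
        Finset.sum_le_sum fun l _ => by
          rw [Finsupp.finsetSum_apply]
          exact Finset.abs_sum_le_sum_abs _ _
    _ = ∑ i, ∑ l ∈ t, |Finsupp.single (k i) (ε i) l| := Finset.sum_comm
    _ ≤ ∑ _i : Fin r, 1 := Finset.sum_le_sum fun i _ => hsingle i
    _ = r := by simp

theorem degree_le_of_mixedRadix {b Q : ℕ → ℤ} (hb0 : b 0 ≠ 0) (hb : ∀ l, b (l + 1) = Q l * b l)
    (hQ : ∀ l, 0 < Q l) {N : ℕ} {q : ℤ} (hN : ∀ l, N ≤ l → 2 * q < Q l) {a : ℕ →₀ ℤ}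
    (ha : ∀ l, 0 ≤ a l) (haq : ∀ l, a l ≤ q)
    (h : IsWordOfLength (Set.range b) r (Finsupp.linearCombination ℤ b a)) :
    a.degree ≤ r + N * (2 * q) := by
  obtain ⟨c, hc, hcr⟩ := h.exists_linearCombination
  obtain ⟨L, hL⟩ := (a.support ∪ c.support).exists_nat_subset_range
  obtain ⟨haL, hcL⟩ := Finset.union_subset_iff.1 hL
  have hac : ∑ l ∈ Finset.range L, a l * b l = ∑ l ∈ Finset.range L, c l * b l := by
    rw [Finsupp.linearCombination_apply, Finsupp.linearCombination_apply,
      Finsupp.sum_of_support_subset _ haL _ (by simp),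
      Finsupp.sum_of_support_subset _ hcL _ (by simp)] at hc
    simpa using hc.symm
  calc a.degree = ∑ l ∈ Finset.range L, a l :=
        Finset.sum_subset haL fun l _ hl => Finsupp.notMem_support_iff.1 hl
    _ ≤ ∑ l ∈ Finset.range L, |c l| + N * (2 * q) :=
        sum_le_sum_abs_add_of_mixedRadix hb0 hb hQ ((ha 0).trans (haq 0)) hN ha haq hac
    _ ≤ r + N * (2 * q) := by gcongr; exact hcr _

end IsWordOfLength

section WordLength

variable {S : Set ℤ}

theorem wordLength_zero (S : Set ℤ) : wordLength S 0 = 0 :=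
  Nat.le_zero.1 (IsWordOfLength.zero S).wordLength_le

theorem wordLength_le_one {n : ℤ} (hn : n ∈ S) : wordLength S n ≤ 1 :=
  (IsWordOfLength.of_mem hn).wordLength_le

theorem isWordOfLength_wordLength (hS : AddSubgroup.closure S = ⊤) (n : ℤ) :
    IsWordOfLength S (wordLength S n) n := by
  have hn : n ∈ AddSubgroup.closure S := hS ▸ AddSubgroup.mem_top n
  refine Nat.sInf_mem (s := {r | IsWordOfLength S r n}) ?_
  induction hn using AddSubgroup.closure_induction with
  | mem n hn => exact ⟨1, .of_mem hn⟩
  | zero => exact ⟨0, .zero S⟩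
  | add m n _ _ hm hn => exact ⟨_, hm.some_mem.add hn.some_mem⟩
  | neg n _ hn => exact ⟨_, hn.some_mem.neg⟩

theorem wordLength_add_le (hS : AddSubgroup.closure S = ⊤) (m n : ℤ) :
    wordLength S (m + n) ≤ wordLength S m + wordLength S n :=
  ((isWordOfLength_wordLength hS m).add (isWordOfLength_wordLength hS n)).wordLength_le

theorem wordLength_sum_le (hS : AddSubgroup.closure S = ⊤) {ι : Type*} (s : Finset ι) (f : ι → ℤ) :
    wordLength S (∑ i ∈ s, f i) ≤ ∑ i ∈ s, wordLength S (f i) :=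
  Finset.le_sum_of_subadditive _ (wordLength_zero S).le (wordLength_add_le hS) s f

theorem wordLength_sum_le_card (hS : AddSubgroup.closure S = ⊤) {ι : Type*} (s : Finset ι)
    {f : ι → ℤ} (hf : ∀ i ∈ s, f i ∈ S) : wordLength S (∑ i ∈ s, f i) ≤ s.card :=
  (wordLength_sum_le hS s f).trans <|
    (Finset.sum_le_card_nsmul s _ 1 fun i hi => wordLength_le_one (hf i hi)).trans_eq (by simp)

end WordLength

section SquarePowers

theorem two_pow_sq_mem_squarePowers (k : ℕ) : (2 : ℤ) ^ k ^ 2 ∈ squarePowers := ⟨k, rfl⟩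

theorem closure_squarePowers : AddSubgroup.closure squarePowers = ⊤ := by
  rw [eq_top_iff, ← Int.addSubgroupClosure_one]
  exact AddSubgroup.closure_mono (Set.singleton_subset_iff.2 (two_pow_sq_mem_squarePowers 0))

theorem squarePowerSum_strictMono : StrictMono squarePowerSum :=
  strictMono_nat_of_lt_succ fun k => by
    rw [squarePowerSum, squarePowerSum, Finset.sum_range_succ _ (k + 1)]
    exact lt_add_of_pos_right _ (by positivity)

theorem wordLength_squarePowerSum_le (k : ℕ) :
    wordLength squarePowers (squarePowerSum k) ≤ k + 1 :=
  (wordLength_sum_le_card closure_squarePowers (Finset.range (k + 1))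
    fun i _ => two_pow_sq_mem_squarePowers i).trans_eq (Finset.card_range _)

variable {ι : Type*}

theorem sum_add_one_le_wordLength_sum_squarePowerSum (s : Finset ι) (k : ι → ℕ) :
    ∑ i ∈ s, (k i + 1) ≤
      wordLength squarePowers (∑ i ∈ s, squarePowerSum (k i)) + 2 * s.card ^ 2 := by
  classical
  let a : ℕ →₀ ℤ := ∑ i ∈ s, ∑ l ∈ Finset.range (k i + 1), Finsupp.single l 1
  have ha : ∀ l, a l = (s.filter fun i => l < k i + 1).card := fun l => by
    simp [a, Finsupp.finsetSum_apply, Finsupp.single_apply]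
  have hword : IsWordOfLength squarePowers
      (wordLength squarePowers (∑ i ∈ s, squarePowerSum (k i)))
      (Finsupp.linearCombination ℤ (fun l : ℕ => (2 : ℤ) ^ l ^ 2) a) := by
    have hlin : Finsupp.linearCombination ℤ (fun l : ℕ => (2 : ℤ) ^ l ^ 2) a =
        ∑ i ∈ s, squarePowerSum (k i) := by
      simp [a, squarePowerSum]
    rw [hlin]
    exact isWordOfLength_wordLength closure_squarePowers _
  have hradix : ∀ l : ℕ, (2 : ℤ) ^ (l + 1) ^ 2 = 2 ^ (2 * l + 1) * 2 ^ l ^ 2 := fun l => by ring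
  have hlarge : ∀ l : ℕ, s.card ≤ l → 2 * (s.card : ℤ) < 2 ^ (2 * l + 1) := fun l hl => by
    have : 2 * l + 1 < 2 ^ (2 * l + 1) := Nat.lt_two_pow_self
    exact_mod_cast (by omega : 2 * s.card < 2 ^ (2 * l + 1))
  have hdegree := hword.degree_le_of_mixedRadix (by simp) hradix (fun l => by positivity) hlarge
    (fun l => by rw [ha]; positivity)
    (fun l => by rw [ha]; exact_mod_cast Finset.card_filter_le s _)
  have hsum : a.degree = ∑ i ∈ s, ((k i : ℤ) + 1) := by simp [a]
  rw [hsum] at hdegree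
  zify
  linarith

theorem add_one_le_wordLength_squarePowerSum (k : ℕ) :
    k + 1 ≤ wordLength squarePowers (squarePowerSum k) + 2 := by
  simpa using sum_add_one_le_wordLength_sum_squarePowerSum {k} id

theorem sum_two_pow_sq_le (J : ℕ) : ∑ i ∈ Finset.range J, 2 ^ i ^ 2 ≤ 2 ^ J ^ 2 := by
  induction J with
  | zero => simp
  | succ J ih =>
    calc ∑ i ∈ Finset.range (J + 1), 2 ^ i ^ 2 ≤ 2 ^ J ^ 2 + 2 ^ J ^ 2 := by
          rw [Finset.sum_range_succ]
          gcongr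
      _ = 2 ^ (J ^ 2 + 1) := by ring
      _ ≤ 2 ^ (J + 1) ^ 2 := Nat.pow_le_pow_right two_pos (by rw [add_sq]; omega)

/-- The parts of the `n_{k i}` below `2 ^ J ^ 2` add up to a multiple of `2 ^ J ^ 2`, which is a
word of length at most `2 ^ J ^ 2`, although the parts together have `#s * J` letters. -/
theorem wordLength_sum_squarePowerSum_add_le {s : Finset ι} {k : ι → ℕ} {J : ℕ}
    (hk : ∀ i ∈ s, J ≤ k i) (hs : s.card = 2 ^ J ^ 2) :
    wordLength squarePowers (∑ i ∈ s, squarePowerSum (k i)) + s.card * J ≤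
      ∑ i ∈ s, (k i + 1) + s.card := by
  have hlow : wordLength squarePowers (∑ _i ∈ s, ∑ l ∈ Finset.range J, 2 ^ l ^ 2) ≤ s.card := by
    have hmul : ∑ _i ∈ s, ∑ l ∈ Finset.range J, (2 : ℤ) ^ l ^ 2 =
        ∑ _j ∈ Finset.range (∑ l ∈ Finset.range J, 2 ^ l ^ 2), 2 ^ J ^ 2 := by
      simp [hs, mul_comm]
    rw [hmul, hs]
    refine (wordLength_sum_le_card closure_squarePowers _
      fun _ _ => two_pow_sq_mem_squarePowers J).trans ?_
    simpa using sum_two_pow_sq_le J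
  have hhigh : wordLength squarePowers (∑ i ∈ s, ∑ l ∈ Finset.Ico J (k i + 1), 2 ^ l ^ 2) ≤
      ∑ i ∈ s, (k i + 1 - J) :=
    (wordLength_sum_le closure_squarePowers _ _).trans <| Finset.sum_le_sum fun i _ =>
      (wordLength_sum_le_card closure_squarePowers _
        fun l _ => two_pow_sq_mem_squarePowers l).trans_eq (Nat.card_Ico _ _)
  have hsplit : ∑ i ∈ s, squarePowerSum (k i) = ∑ _i ∈ s, ∑ l ∈ Finset.range J, 2 ^ l ^ 2 +
      ∑ i ∈ s, ∑ l ∈ Finset.Ico J (k i + 1), 2 ^ l ^ 2 := by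
    rw [← Finset.sum_add_distrib]
    exact Finset.sum_congr rfl fun i hi =>
      (Finset.sum_range_add_sum_Ico _ ((hk i hi).trans (k i).le_succ)).symm
  have hcount : ∑ i ∈ s, (k i + 1 - J) + s.card * J = ∑ i ∈ s, (k i + 1) := by
    rw [← smul_eq_mul, ← Finset.sum_const, ← Finset.sum_add_distrib]
    exact Finset.sum_congr rfl fun i hi => Nat.sub_add_cancel ((hk i hi).trans (k i).le_succ)
  have hadd := wordLength_add_le closure_squarePowers
    (∑ _i ∈ s, ∑ l ∈ Finset.range J, 2 ^ l ^ 2) (∑ i ∈ s, ∑ l ∈ Finset.Ico J (k i + 1), 2 ^ l ^ 2)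
  rw [hsplit]
  omega

end SquarePowers

/-! ## Point masses in Beurling algebras -/

theorem Weight.pos (ω : Weight) (n : ℤ) : 0 < ω n := zero_lt_one.trans_le (ω.one_le n)

namespace Beurling

variable {ω : Weight}

theorem norm_delta (n : ℤ) : ‖delta ω n‖ = ω n := by
  rw [norm_def, tsum_eq_single n fun m hm => by simp [delta_apply, hm]]
  simp [delta_apply]

theorem delta_zero : delta ω 0 = 1 := rfl

theorem delta_mul_delta (m n : ℤ) : delta ω m * delta ω n = delta ω (m + n) := by
  ext k
  rw [mul_apply, tsum_eq_single m fun j hj => by simp [delta_apply, hj]]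
  simp [delta_apply, sub_eq_iff_eq_add, add_comm]

section Pairing

variable {φ : ℤ → ℂ} {C : ℝ}

theorem norm_apply_mul_le (hφ : ∀ n, ‖φ n‖ ≤ C * ω n) (f : Beurling ω) (n : ℤ) :
    ‖f n * φ n‖ ≤ C * (‖f n‖ * ω n) := by
  rw [norm_mul, mul_left_comm]
  exact mul_le_mul_of_nonneg_left (hφ n) (norm_nonneg _)

theorem summable_apply_mul (hφ : ∀ n, ‖φ n‖ ≤ C * ω n) (f : Beurling ω) :
    Summable fun n => f n * φ n :=
  Summable.of_norm_bounded (f.summable_weighted.mul_left C) (norm_apply_mul_le hφ f)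

/-- The functional `f ↦ ∑ f n φ n` on `ℓ¹(ℤ, ω)` given by a function `φ` with `φ / ω` bounded. -/
noncomputable def pairing (φ : ℤ → ℂ) (hφ : ∀ n, ‖φ n‖ ≤ C * ω n) : StrongDual ℂ (Beurling ω) :=
  LinearMap.mkContinuous
    { toFun := fun f => ∑' n, f n * φ n
      map_add' := fun f g => by
        rw [← (summable_apply_mul hφ f).tsum_add (summable_apply_mul hφ g)]
        exact tsum_congr fun n => by rw [add_apply, add_mul]
      map_smul' := fun c f => by
        rw [RingHom.id_apply, smul_eq_mul, ← tsum_mul_left]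
        exact tsum_congr fun n => by rw [smul_apply, mul_assoc] }
    C fun f =>
      tsum_of_norm_bounded (f.summable_weighted.hasSum.mul_left C) (norm_apply_mul_le hφ f)

theorem pairing_delta (hφ : ∀ n, ‖φ n‖ ≤ C * ω n) (n : ℤ) :
    pairing φ hφ (delta ω n) = φ n := by
  change ∑' m, delta ω n m * φ m = φ n
  rw [tsum_eq_single n fun m hm => by simp [delta_apply, hm]]
  simp [delta_apply]

end Pairing

/-- The normalized point mass `δ_n / ω(n)`. -/
noncomputable def unitDelta (ω : Weight) (n : ℤ) : Beurling ω := (ω n : ℂ)⁻¹ • delta ω n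

theorem unitDelta_injective : Function.Injective (unitDelta ω) := by
  intro m n h
  by_contra hmn
  have hm : unitDelta ω m m = unitDelta ω n m := by rw [h]
  simp [unitDelta, delta_apply, hmn, (ω.pos m).ne'] at hm

theorem prod_unitDelta {ι : Type*} (s : Finset ι) (n : ι → ℤ) :
    ∏ i ∈ s, unitDelta ω (n i) =
      ((∏ i ∈ s, ω (n i) : ℝ) : ℂ)⁻¹ • delta ω (∑ i ∈ s, n i) := by
  classical
  induction s using Finset.induction_on with
  | empty => simp [delta_zero]
  | insert i s hi ih =>
    rw [Finset.prod_insert hi, Finset.prod_insert hi, Finset.sum_insert hi, ih, unitDelta,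
      smul_mul_smul_comm, delta_mul_delta, Complex.ofReal_mul, mul_inv]

theorem norm_prod_unitDelta {ι : Type*} (s : Finset ι) (n : ι → ℤ) :
    ‖∏ i ∈ s, unitDelta ω (n i)‖ = ω (∑ i ∈ s, n i) / ∏ i ∈ s, ω (n i) := by
  have hpos : 0 < ∏ i ∈ s, ω (n i) := Finset.prod_pos fun i _ => ω.pos (n i)
  rw [prod_unitDelta, norm_smul, norm_delta, norm_inv, Complex.norm_real,
    Real.norm_of_nonneg hpos.le, div_eq_inv_mul]

theorem norm_unitDelta (n : ℤ) : ‖unitDelta ω n‖ = 1 := by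
  simpa [(ω.pos n).ne'] using norm_prod_unitDelta (ω := ω) {n} id

end Beurling

/-- The normalized point masses at the integers `n k` with `k ≥ K`. -/
def tailPointMasses (ω : Weight) (n : ℕ → ℤ) (K : ℕ) : Set (Beurling ω) :=
  (fun k => Beurling.unitDelta ω (n k)) '' Set.Ici K

open scoped Pointwise in
theorem exists_of_mem_tailPointMasses_pow {ω : Weight} {n : ℕ → ℤ} {K r : ℕ} {a : Beurling ω}
    (ha : a ∈ tailPointMasses ω n K ^ r) :
    ∃ k : Fin r → ℕ, (∀ i, K ≤ k i) ∧ ∏ i, Beurling.unitDelta ω (n (k i)) = a := by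
  obtain ⟨f, hf, rfl⟩ := Set.mem_pow_iff_prod.1 ha
  choose k hk hkf using hf
  exact ⟨k, hk, Finset.prod_congr rfl fun i _ => hkf i⟩

theorem normalizedPointMasses_eq (ω : Weight) : normalizedPointMasses ω =
    (fun a => (Bidual.embed a).toWeakStar) '' tailPointMasses ω squarePowerSum 1 := by
  ext x
  constructor
  · rintro ⟨k, hk, rfl⟩
    exact ⟨_, ⟨k, hk, rfl⟩, rfl⟩
  · rintro ⟨_, ⟨k, hk, rfl⟩, rfl⟩
    exact ⟨k, hk, rfl⟩

theorem exists_accPt_normalizedPointMasses (ω : Weight) :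
    ∃ Φ : Bidual (Beurling ω),
      AccPt Φ.toWeakStar (Filter.principal (normalizedPointMasses ω)) := by
  rw [normalizedPointMasses_eq]
  refine Bidual.exists_accPt_of_isBounded_of_infinite
    (isBounded_iff_forall_norm_le.2 ⟨1, ?_⟩) ?_
  · rintro _ ⟨k, -, rfl⟩
    exact (Beurling.norm_unitDelta _).le
  · exact (Set.Ici_infinite 1).image
      (Beurling.unitDelta_injective.comp squarePowerSum_strictMono.injective).injOn

theorem mem_weakStarClosure_tailPointMasses_of_accPt {ω : Weight} {Φ : Bidual (Beurling ω)}
    (h : AccPt Φ.toWeakStar (Filter.principal (normalizedPointMasses ω))) (K : ℕ) :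
    Φ ∈ Bidual.weakStarClosure (tailPointMasses ω squarePowerSum K) := by
  let x : ℕ → WeakDual ℂ (StrongDual ℂ (Beurling ω)) := fun k =>
    (Bidual.embed (Beurling.unitDelta ω (squarePowerSum k))).toWeakStar
  have hx : normalizedPointMasses ω ⊆ x '' Set.Iio K ∪
      (fun a => (Bidual.embed a).toWeakStar) '' tailPointMasses ω squarePowerSum K := by
    rintro _ ⟨k, -, rfl⟩
    rcases lt_or_ge k K with hk | hk
    · exact Or.inl ⟨k, hk, rfl⟩
    · exact Or.inr ⟨_, ⟨k, hk, rfl⟩, rfl⟩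
  have hclosure := mem_closure_of_accPt_of_subset_union h ((Set.finite_Iio K).image x) hx
  exact hclosure

/-! ## The weight given by word length -/

/-- The weight `n ↦ exp |n|`, where `|n|` is the word length with respect to `S`. -/
noncomputable def wordWeight (S : Set ℤ) (hS : AddSubgroup.closure S = ⊤) : Weight where
  toFun n := Real.exp (wordLength S n)
  one_le' n := Real.one_le_exp (Nat.cast_nonneg _)
  map_add_le' m n := by
    rw [← Real.exp_add, Real.exp_le_exp]
    exact_mod_cast wordLength_add_le hS m n
  map_zero' := by simp [wordLength_zero]

theorem wordWeight_sum_div_prod {S : Set ℤ} (hS : AddSubgroup.closure S = ⊤) {ι : Type*}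
    (s : Finset ι) (n : ι → ℤ) :
    wordWeight S hS (∑ i ∈ s, n i) / ∏ i ∈ s, wordWeight S hS (n i) =
      Real.exp (wordLength S (∑ i ∈ s, n i) - ∑ i ∈ s, (wordLength S (n i) : ℝ)) := by
  rw [Real.exp_sub, Real.exp_sum]
  rfl

/-- The weight of the theorem, `n ↦ exp |n|` for the generating set `{2 ^ (k ^ 2)}`. -/
noncomputable abbrev squareWeight : Weight := wordWeight squarePowers closure_squarePowers

section SquareWeight

variable {ι : Type*}

theorem exp_neg_le_squareWeight_sum_div_prod (s : Finset ι) (k : ι → ℕ) :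
    Real.exp (-(2 * s.card ^ 2)) ≤
      squareWeight (∑ i ∈ s, squarePowerSum (k i)) /
        ∏ i ∈ s, squareWeight (squarePowerSum (k i)) := by
  have hletters : ∑ i ∈ s, wordLength squarePowers (squarePowerSum (k i)) ≤
      wordLength squarePowers (∑ i ∈ s, squarePowerSum (k i)) + 2 * s.card ^ 2 :=
    (Finset.sum_le_sum fun i _ => wordLength_squarePowerSum_le (k i)).trans
      (sum_add_one_le_wordLength_sum_squarePowerSum s k)
  rw [wordWeight_sum_div_prod, Real.exp_le_exp]
  rify at hletters
  linarith

theorem squareWeight_sum_div_prod_le {s : Finset ι} {k : ι → ℕ} {J : ℕ}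
    (hk : ∀ i ∈ s, J ≤ k i) (hs : s.card = 2 ^ J ^ 2) :
    squareWeight (∑ i ∈ s, squarePowerSum (k i)) / ∏ i ∈ s, squareWeight (squarePowerSum (k i)) ≤
      Real.exp (3 - J) ^ s.card := by
  have hletters : ∑ i ∈ s, (k i + 1) ≤
      ∑ i ∈ s, wordLength squarePowers (squarePowerSum (k i)) + s.card * 2 := by
    rw [← smul_eq_mul, ← Finset.sum_const, ← Finset.sum_add_distrib]
    exact Finset.sum_le_sum fun i _ => add_one_le_wordLength_squarePowerSum (k i)
  have hshort := (wordLength_sum_squarePowerSum_add_le hk hs).trans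
    (Nat.add_le_add_right hletters _)
  rw [wordWeight_sum_div_prod, ← Real.exp_nat_mul, Real.exp_le_exp]
  rify at hshort
  linarith

variable {Φ : Bidual (Beurling squareWeight)}

theorem mem_jacobson_of_accPt
    (h : AccPt Φ.toWeakStar (Filter.principal (normalizedPointMasses squareWeight))) :
    Φ ∈ Ring.jacobson (Bidual (Beurling squareWeight)) := by
  refine Bidual.mem_jacobson_of_mem_weakStarClosure fun ε hε => ?_
  obtain ⟨J, hJ⟩ := exists_nat_ge (3 - Real.log ε)
  have hJε : Real.exp (3 - J) ≤ ε := (Real.le_log_iff_exp_le hε).1 (by linarith)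
  refine ⟨tailPointMasses squareWeight squarePowerSum J,
    mem_weakStarClosure_tailPointMasses_of_accPt h J, 2 ^ J ^ 2, by positivity, fun a ha => ?_⟩
  obtain ⟨k, hk, rfl⟩ := exists_of_mem_tailPointMasses_pow ha
  have hcard : (Finset.univ : Finset (Fin (2 ^ J ^ 2))).card = 2 ^ J ^ 2 := Finset.card_fin _
  calc ‖∏ i, Beurling.unitDelta squareWeight (squarePowerSum (k i))‖
      ≤ Real.exp (3 - J) ^ (Finset.univ : Finset (Fin (2 ^ J ^ 2))).card := by
        rw [Beurling.norm_prod_unitDelta]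
        exact squareWeight_sum_div_prod_le (fun i _ => hk i) hcard
    _ ≤ ε ^ 2 ^ J ^ 2 := by rw [hcard]; gcongr

theorem not_isNilpotent_of_accPt
    (h : AccPt Φ.toWeakStar (Filter.principal (normalizedPointMasses squareWeight))) :
    ¬ IsNilpotent Φ := by
  have hω : ∀ n, ‖(squareWeight n : ℂ)‖ ≤ 1 * squareWeight n := fun n => by
    rw [one_mul, Complex.norm_real, Real.norm_of_nonneg (squareWeight.nonneg n)]
  refine Bidual.not_isNilpotent_of_mem_weakStarClosure
    (mem_weakStarClosure_tailPointMasses_of_accPt h 0) (Beurling.pairing _ hω)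
    fun r => ⟨Real.exp (-(2 * r ^ 2)), Real.exp_pos _, fun a ha => ?_⟩
  obtain ⟨k, -, rfl⟩ := exists_of_mem_tailPointMasses_pow ha
  rw [Beurling.prod_unitDelta, map_smul, Beurling.pairing_delta, smul_eq_mul,
    ← Complex.ofReal_inv, ← Complex.ofReal_mul, Complex.ofReal_re, ← div_eq_inv_mul]
  simpa using exp_neg_le_squareWeight_sum_div_prod Finset.univ k

end SquareWeight

theorem theorem1p2 :
    ∃ ω : Weight, (∀ n : ℤ, ω n = Real.exp (wordLength squarePowers n)) ∧
      (∃ Φ : Bidual (Beurling ω), Φ ∈ Ring.jacobson (Bidual (Beurling ω)) ∧ ¬ IsNilpotent Φ) ∧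
      (∃ Φ : Bidual (Beurling ω),
        AccPt Φ.toWeakStar (Filter.principal (normalizedPointMasses ω))) ∧
      ∀ Φ : Bidual (Beurling ω),
        AccPt Φ.toWeakStar (Filter.principal (normalizedPointMasses ω)) →
          Φ ∈ Ring.jacobson (Bidual (Beurling ω)) ∧ ¬ IsNilpotent Φ := by
  obtain ⟨Φ, hΦ⟩ := exists_accPt_normalizedPointMasses squareWeight
  exact ⟨squareWeight, fun _ => rfl,
    ⟨Φ, mem_jacobson_of_accPt hΦ, not_isNilpotent_of_accPt hΦ⟩, ⟨Φ, hΦ⟩,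
    fun _ hΨ => ⟨mem_jacobson_of_accPt hΨ, not_isNilpotent_of_accPt hΨ⟩⟩
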